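/- All subgroups are closed, homomorphisms are continuous, and generation is topological. Let $G$ be a profinite group. The pro-Fitting subgroup $F(G)$ is the subgroup generated by all subnormal subgroups of $G$ that are pro-$p$ for some prime $p$. A profinite group $Q$ is quasisimple if it is perfect and $Q/Z(Q)$ is simple; a component of $G$ is a subnormal quasisimple subgroup, the layer $E(G)$ is the subgroup generated by all components of $G$, and the generalised pro-Fitting subgroup $F^*(G)$ is the subgroup generated by $E(G)$ and $F(G)$. Say that $G$ is Fitting-regular if $F^*(G/N) \neq 1$ for every proper closed normal subgroup $N$ of $G$. \textbf{Theorem.} If $G$ is a Fitting-regular profinite group, then $C_G(F^*(G)) = Z(F(G))$. In particular, $C_G(F^*(G)) \leq F^*(G)$. -/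

import Mathlib

/-!
A profinite group is a compact totally disconnected topological group. Subgroups are meant to be
closed, homomorphisms to be continuous, and generation to be topological generation.
-/

namespace ProfiniteFitting

section

universe u

variable (G : Type u) [Group G] [TopologicalSpace G]

/-- Pro-`p` (for a profinite group `G`): every quotient by an open normal subgroup is a
`p`-group. -/
def IsProP (p : ℕ) : Prop :=
  ∀ U : OpenNormalSubgroup G, IsPGroup p (G ⧸ (U : Subgroup G))

/-- Simple, with respect to closed normal subgroups. -/
def IsTopSimple : Prop :=
  Nontrivial G ∧ ∀ N : Subgroup G, N.Normal → IsClosed (N : Set G) → N = ⊥ ∨ N = ⊤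

/-- Perfect: the commutators generate `G` topologically. -/
def IsTopPerfect [IsTopologicalGroup G] : Prop :=
  (commutator G).topologicalClosure = ⊤

/-- Quasisimple: perfect, with `G / Z(G)` simple. -/
def IsQuasisimple [IsTopologicalGroup G] : Prop :=
  IsTopPerfect G ∧ IsTopSimple (G ⧸ Subgroup.center G)

variable {G} in
/-- A closed subnormal subgroup. (Taking closures termwise in a subnormal chain ending in a closed
subgroup gives a subnormal chain of closed subgroups, so it does not matter whether the
intermediate terms are required to be closed.) -/
def IsClosedSubnormal (H : Subgroup G) : Prop :=
  H.IsSubnormal ∧ IsClosed (H : Set G)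

variable {G} in
/-- A component: a subnormal subgroup that is quasisimple. -/
def IsComponent [IsTopologicalGroup G] (Q : Subgroup G) : Prop :=
  IsClosedSubnormal Q ∧ IsQuasisimple Q

/-- The pro-Fitting subgroup `F(G)`: topologically generated by all subnormal pro-`p` subgroups,
over all primes `p`. -/
def proFitting [IsTopologicalGroup G] : Subgroup G :=
  (sSup {H : Subgroup G | IsClosedSubnormal H ∧ ∃ p : ℕ, p.Prime ∧ IsProP H p}).topologicalClosure

/-- The layer `E(G)`: topologically generated by all components. -/
def layer [IsTopologicalGroup G] : Subgroup G :=
  (sSup {Q : Subgroup G | IsComponent Q}).topologicalClosure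

/-- The generalised pro-Fitting subgroup `F*(G)`: topologically generated by `E(G)` and `F(G)`. -/
def genProFitting [IsTopologicalGroup G] : Subgroup G :=
  (layer G ⊔ proFitting G).topologicalClosure

/-- Fitting-degenerate: `F*(G) = 1`. -/
def IsFittingDegenerate [IsTopologicalGroup G] : Prop :=
  genProFitting G = ⊥

/-- Fitting-regular: no non-trivial image of `G` is Fitting-degenerate. The (continuous, profinite)
images of a profinite group are, up to isomorphism, its quotients by closed normal subgroups. -/
def IsFittingRegular [IsTopologicalGroup G] : Prop :=
  ∀ (N : Subgroup G) [N.Normal], IsClosed (N : Set G) → Nontrivial (G ⧸ N) →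
    ¬ IsFittingDegenerate (G ⧸ N)

end

end ProfiniteFitting

/-! Let `C` centralise `F*(G)`, put `Z = C ∩ F(G)`, which is central in `C`, and let `K` be the
centraliser of `C/Z`. Since `C ∩ K` has class at most two, it lies in `F(G)`, so `C ∩ K ≤ Z`
(`inf_quotientCentralizer_le`). It remains to see `K = G`; by regularity it is enough that `F*(G/K)
= 1`.

A subnormal pro-`p` subgroup of `G/K` lies in a closed normal one, with preimage `X`. Modulo central
elements `X ∩ C` consists of `p`-elements, so it lies in `F(G)`, hence in `Z`; then `[X, C] ≤ Z`,
that is, `X ≤ K` (`eq_bot_of_isProP_quotient`). A component of `G/K` either centralises the image of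
`C`, and is then trivial, or lies in that image and lifts through a central kernel to a component of
`G` inside `C` (`exists_isComponent_le_of_quotient`). The latter would lie in `F*(G)` and so be
abelian, which is absurd.

Conversely, `Z(F(G))` is an abelian closed normal subgroup; it cannot contain a component, so it
centralises each one (`inf_centralizer_le_centralizer_genProFitting`). -/

namespace ProfiniteFitting

open Subgroup
open scoped commutatorElement

/-! ### Pro-`p` elements, `p`-parts, and normal closures of subnormal pro-`p` subgroups. -/

section PElements

open Filter Topology

variable {G : Type*} [Group G]

/-- A subgroup generated by normal subgroups, each of which is a `p`-group modulo `W`, is a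
`p`-group modulo `W`. -/
lemma exists_pow_mem_of_mem_sSup_of_normal {p : ℕ} (W : Subgroup G) [W.Normal]
    (S : Set (Subgroup G)) (hn : ∀ H ∈ S, H.Normal)
    (hp : ∀ H ∈ S, ∀ h ∈ H, ∃ k : ℕ, h ^ p ^ k ∈ W) {x : G} (hx : x ∈ sSup S) :
    ∃ k : ℕ, x ^ p ^ k ∈ W := by
  have key : IsPGroup p (⨆ H ∈ S, H.map (QuotientGroup.mk' W) : Subgroup (G ⧸ W)) := by
    refine Sylow.biSup_of_normal S _ (fun H hH => ?_) fun H hH =>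
      (hn H hH).map _ (QuotientGroup.mk'_surjective W)
    rintro ⟨_, h, hh, rfl⟩
    obtain ⟨k, hk⟩ := hp H hH h hh
    refine ⟨k, Subtype.ext ?_⟩
    simpa using (QuotientGroup.eq_one_iff (N := W) _).2 hk
  have hx' : QuotientGroup.mk' W x ∈ (⨆ H ∈ S, H.map (QuotientGroup.mk' W)) := by
    have := mem_map_of_mem (QuotientGroup.mk' W) hx
    rwa [sSup_eq_iSup, Subgroup.map_iSup, iSup_congr fun H => Subgroup.map_iSup _ _] at this
  obtain ⟨k, hk⟩ := key ⟨_, hx'⟩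
  refine ⟨k, (QuotientGroup.eq_one_iff (N := W) _).1 ?_⟩
  simpa using congrArg Subtype.val hk

/-- In a finite nilpotent group, the product of two `p`-elements is a `p`-element. -/
lemma exists_mul_pow_eq_one_of_isNilpotent [Finite G] [Group.IsNilpotent G] {p : ℕ}
    (hp : p.Prime) {x y : G} (hx : ∃ k : ℕ, x ^ p ^ k = 1) (hy : ∃ k : ℕ, y ^ p ^ k = 1) :
    ∃ k : ℕ, (x * y) ^ p ^ k = 1 := by
  have := Fact.mk hp
  have hsyl : ∀ P : Sylow p G, P.Normal := fun P =>
    (Group.isNilpotent_of_finite_tfae (G := G)).out 0 3 rfl rfl |>.mp ‹_› p ‹_› P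
  let P : Sylow p G := default
  have hP : ∀ z : G, (∃ k : ℕ, z ^ p ^ k = 1) → z ∈ P := by
    rintro z ⟨k, hk⟩
    have hz : IsPGroup p (zpowers z) := by
      rintro ⟨w, hw⟩
      obtain ⟨n, rfl⟩ := mem_zpowers_iff.1 hw
      refine ⟨k, Subtype.ext ?_⟩
      show (z ^ n) ^ p ^ k = 1
      rw [← zpow_natCast, ← zpow_mul, mul_comm, zpow_mul, zpow_natCast, hk, one_zpow]
    obtain ⟨Q, hQ⟩ := hz.exists_le_sylow
    have := hsyl P
    have : Subsingleton (Sylow p G) := (Sylow.unique_of_normal P inferInstance).instSubsingleton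
    rw [Subsingleton.elim P Q]
    exact hQ (mem_zpowers z)
  obtain ⟨k, hk⟩ := P.isPGroup' ⟨x * y, mul_mem (hP x hx) (hP y hy)⟩
  exact ⟨k, by simpa using congrArg Subtype.val hk⟩

lemma isNilpotent_of_forall_commutator_mem_center
    (h : ∀ a b : G, ⁅a, b⁆ ∈ center G) : Group.IsNilpotent G := by
  refine Group.of_quotient_center_nilpotent ?_
  let : CommGroup (G ⧸ center G) :=
    { (inferInstance : Group (G ⧸ center G)) with
      mul_comm := by
        intro a b
        obtain ⟨a, rfl⟩ := QuotientGroup.mk_surjective a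
        obtain ⟨b, rfl⟩ := QuotientGroup.mk_surjective b
        rw [← QuotientGroup.mk_mul, ← QuotientGroup.mk_mul, QuotientGroup.eq]
        have := h b⁻¹ a⁻¹
        simpa [commutatorElement_def, mul_assoc] using this }
  exact CommGroup.isNilpotent

lemma isNilpotent_of_forall_exists_pow_mem_center [Finite G] {p : ℕ} (hp : p.Prime)
    (h : ∀ a : G, ∃ k : ℕ, a ^ p ^ k ∈ center G) : Group.IsNilpotent G := by
  have := Fact.mk hp
  refine Group.of_quotient_center_nilpotent (IsPGroup.isNilpotent (p := p) ?_)
  intro a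
  obtain ⟨a, rfl⟩ := QuotientGroup.mk_surjective a
  obtain ⟨k, hk⟩ := h a
  exact ⟨k, by rw [← QuotientGroup.mk_pow]; exact (QuotientGroup.eq_one_iff _).2 hk⟩

variable [TopologicalSpace G]

/-- An element whose image in every quotient by an open normal subgroup has order a power
of `p`. -/
def IsProPElement (p : ℕ) (x : G) : Prop :=
  ∀ U : OpenNormalSubgroup G, ∃ k : ℕ, x ^ p ^ k ∈ U

lemma IsProPElement.conj {p : ℕ} {x : G} (hx : IsProPElement p x) (g : G) :
    IsProPElement p (g * x * g⁻¹) := fun U => by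
  obtain ⟨k, hk⟩ := hx U
  exact ⟨k, by rw [conj_pow]; exact U.isNormal'.conj_mem _ hk g⟩

/-- A subnormal subgroup consisting of pro-`p` elements lies in such a normal subgroup. -/
lemma exists_normal_of_isSubnormal {p : ℕ} {H : Subgroup G} (hH : H.IsSubnormal)
    (hp : ∀ h ∈ H, IsProPElement p h) :
    ∃ P : Subgroup G, P.Normal ∧ H ≤ P ∧ ∀ h ∈ P, IsProPElement p h := by
  -- Generalised so that the induction climbs the subnormal chain: a pro-`p` subgroup `S` normalised
  -- by one term is replaced by the group generated by its conjugates under the next.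
  suffices ∀ K : Subgroup G, K.IsSubnormal → ∀ S ≤ K, (∀ s ∈ S, ∀ k ∈ K, k * s * k⁻¹ ∈ S) →
      (∀ h ∈ S, IsProPElement p h) →
      ∃ P : Subgroup G, P.Normal ∧ S ≤ P ∧ ∀ h ∈ P, IsProPElement p h from
    this H hH H le_rfl (fun s hs k hk => mul_mem (mul_mem hk hs) (inv_mem hk)) hp
  intro K hK
  induction hK with
  | top =>
    intro S _ hn hS
    exact ⟨S, ⟨fun s hs g => hn s hs g trivial⟩, le_rfl, hS⟩
  | step H K hHK _ hN ih =>
    intro S hSH hn hS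
    rw [normal_subgroupOf_iff hHK] at hN
    let conjS : K → Subgroup H := fun g => (S.map (MulAut.conj (g : G)).toMonoidHom).subgroupOf H
    have hconj : ∀ (g : K) (x : H), x ∈ conjS g ↔ (g : G)⁻¹ * x * g ∈ S := by
      intro g x
      simp only [conjS, mem_subgroupOf]
      constructor
      · rintro ⟨s, hs, hsx⟩
        rw [← hsx]
        simpa [mul_assoc] using hs
      · intro h
        exact ⟨_, h, by simp [mul_assoc]⟩
    have hnorm : ∀ g : K, (conjS g).Normal := fun g => ⟨fun x hx y => by
      rw [hconj] at hx ⊢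
      have := hn _ hx ((g : G)⁻¹ * y * g) (by simpa using hN y (g : G)⁻¹ y.2 (inv_mem g.2))
      simpa [mul_assoc] using this⟩
    have hmem : ∀ g : K, ∀ x ∈ conjS g, IsProPElement p (x : G) := fun g x hx => by
      simpa [mul_assoc] using (hS _ ((hconj g x).1 hx)).conj (g : G)
    let T : Subgroup G := (sSup (Set.range conjS)).map H.subtype
    have hTn : ∀ s ∈ T, ∀ k ∈ K, k * s * k⁻¹ ∈ T := by
      rintro _ ⟨x, hx, rfl⟩ k hk
      let c : H →* H :=
        { toFun := fun h => ⟨k * h * k⁻¹, hN h k h.2 hk⟩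
          map_one' := by ext; simp
          map_mul' := fun a b => by ext; simp [mul_assoc] }
      refine ⟨c x, ?_, rfl⟩
      have hle : sSup (Set.range conjS) ≤ (sSup (Set.range conjS)).comap c := by
        refine sSup_le ?_
        rintro _ ⟨g, rfl⟩ y hy
        refine le_sSup (show conjS (⟨k, hk⟩ * g) ∈ Set.range conjS from ⟨_, rfl⟩) ?_
        rw [hconj] at hy ⊢
        simpa [c, mul_assoc] using hy
      exact hle hx
    have hTp : ∀ h ∈ T, IsProPElement p h := by
      rintro _ ⟨x, hx, rfl⟩ U
      obtain ⟨k, hk⟩ := exists_pow_mem_of_mem_sSup_of_normal (p := p)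
        ((U : Subgroup G).subgroupOf H) (Set.range conjS) (by rintro _ ⟨g, rfl⟩; exact hnorm g)
        (by
          rintro _ ⟨g, rfl⟩ y hy
          obtain ⟨k, hk⟩ := hmem g y hy U
          exact ⟨k, hk⟩) hx
      exact ⟨k, hk⟩
    obtain ⟨P, hP, hle, hPp⟩ := ih T ((map_subtype_le _).trans hHK) hTn hTp
    refine ⟨P, hP, fun s hs => hle ?_, hPp⟩
    refine ⟨⟨s, hSH hs⟩, ?_, rfl⟩
    exact le_sSup (show conjS 1 ∈ Set.range conjS from ⟨1, rfl⟩)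
      ((hconj 1 _).2 (by simpa using hs))

lemma IsProP.isProPElement {p : ℕ} {H : Subgroup G} (hH : IsProP H p) {h : G} (hh : h ∈ H) :
    IsProPElement p h := fun U => by
  let V : OpenNormalSubgroup H :=
    { toSubgroup := (U : Subgroup G).subgroupOf H
      isOpen' := U.isOpen'.preimage continuous_subtype_val }
  obtain ⟨k, hk⟩ := hH V (⟨h, hh⟩ : H)
  rw [← QuotientGroup.mk_pow] at hk
  have : (⟨h, hh⟩ : H) ^ p ^ k ∈ (U : Subgroup G).subgroupOf H :=
    (QuotientGroup.eq_one_iff _).1 hk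
  exact ⟨k, this⟩

variable [IsTopologicalGroup G]

lemma isClosed_setOf_isProPElement (p : ℕ) : IsClosed {x : G | IsProPElement p x} := by
  have : {x : G | IsProPElement p x} = ⋂ U : OpenNormalSubgroup G,
      (fun x : G => (x : G ⧸ (U : Subgroup G))) ⁻¹' {q | ∃ k : ℕ, q ^ p ^ k = 1} := by
    ext x
    simp only [IsProPElement, Set.mem_ofPred_eq, Set.mem_iInter, Set.mem_preimage]
    refine forall_congr' fun U => exists_congr fun k => ?_
    rw [← QuotientGroup.mk_pow]
    exact (QuotientGroup.eq_one_iff _).symm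
  rw [this]
  refine isClosed_iInter fun U => ?_
  have : DiscreteTopology (G ⧸ (U : Subgroup G)) :=
    inferInstanceAs (DiscreteTopology (G ⧸ U.toOpenSubgroup.toSubgroup))
  exact (isClosed_discrete _).preimage QuotientGroup.continuous_mk

variable [CompactSpace G]

/-- The `p`-part of an element of a profinite group. -/
lemma exists_pPart {p : ℕ} (hp : p.Prime) (x : G) :
    ∃ y ∈ (zpowers x).topologicalClosure, ∀ U : OpenNormalSubgroup G, ∃ (e : ℤ) (k m : ℕ),
      ¬ p ∣ m ∧ y⁻¹ * x ^ e ∈ U ∧ x ^ (e * (p : ℤ) ^ k) ∈ U ∧ x ^ ((1 - e) * (m : ℤ)) ∈ U := by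
  -- These exponents approximate the idempotent of the profinite integers projecting onto the
  -- `p`-adic factor: close to 1 at `p`, close to 0 at other primes. They come from Bézout for `p ^
  -- n` and the `p'`-part of `n!`; a cluster point of `x ^ e n` is the `p`-part.
  have he : ∀ n : ℕ, ∃ e : ℤ, (p : ℤ) ^ n ∣ 1 - e ∧
      ∀ m : ℕ, m ∣ n.factorial → ¬ p ∣ m → (m : ℤ) ∣ e := by
    intro n
    obtain ⟨j, c, hc, hn⟩ := Nat.exists_eq_pow_mul_and_not_dvd (Nat.factorial_ne_zero n) p
      hp.ne_one
    have hco : IsCoprime ((p : ℤ) ^ n) (c : ℤ) := by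
      have := (hp.coprime_iff_not_dvd.2 hc).pow_left n
      exact_mod_cast Nat.isCoprime_iff_coprime.2 this
    obtain ⟨a, b, hab⟩ := hco
    refine ⟨b * c, ⟨a, by linear_combination -hab⟩, fun m hm hpm => ?_⟩
    have hmc : m ∣ c := by
      rw [hn] at hm
      exact (((hp.coprime_iff_not_dvd.2 hpm).symm).pow_right j).dvd_of_dvd_mul_left hm
    exact Dvd.dvd.mul_left (by exact_mod_cast hmc) b
  choose e he1 he2 using he
  obtain ⟨y, hy⟩ := exists_clusterPt_of_compactSpace (map (fun n : ℕ => x ^ e n) atTop)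
  have hy' : MapClusterPt y atTop (fun n : ℕ => x ^ e n) := hy
  refine ⟨y, ?_, fun U => ?_⟩
  · rw [← SetLike.mem_coe, topologicalClosure_coe, mem_closure_iff_frequently]
    refine frequently_iff.2 fun {V} hV => ?_
    obtain ⟨n, hn⟩ := (hy'.frequently hV).exists
    exact ⟨_, hn, e n, rfl⟩
  · have : Finite (G ⧸ (U : Subgroup G)) :=
      Subgroup.quotient_finite_of_isOpen _ U.isOpen'
    have ho : ∀ c : ℤ, (Nat.card (G ⧸ (U : Subgroup G)) : ℤ) ∣ c → x ^ c ∈ U := by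
      rintro _ ⟨c, rfl⟩
      refine (QuotientGroup.eq_one_iff (N := (U : Subgroup G)) _).1 ?_
      rw [QuotientGroup.mk_zpow, zpow_mul, zpow_natCast, pow_card_eq_one', one_zpow]
    obtain ⟨k, m, hm, hcard⟩ := Nat.exists_eq_pow_mul_and_not_dvd
      (Nat.card_pos (α := G ⧸ (U : Subgroup G))).ne' p hp.ne_one
    have hV : (fun g => y⁻¹ * g) ⁻¹' (U : Set G) ∈ 𝓝 y :=
      (U.isOpen'.preimage (by fun_prop)).mem_nhds (by
        show y⁻¹ * y ∈ U
        rw [inv_mul_cancel]; exact U.one_mem)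
    -- The index of `U` is `p ^ k * m`; the bound `n ≥ k + m` gives both `m ∣ n!` and `p ^ k ∣ p ^
    -- n`.
    obtain ⟨n, hn, hnk⟩ := ((hy'.frequently hV).and_eventually
      (eventually_ge_atTop (k + m))).exists
    refine ⟨e n, k, m, hm, hn, ho _ ?_, ho _ ?_⟩ <;> rw [hcard] <;> push_cast
    · rw [mul_comm]
      refine mul_dvd_mul_right (he2 n m ?_ hm) _
      refine Nat.dvd_factorial (Nat.pos_of_ne_zero ?_) (by omega)
      rintro rfl; exact hm (dvd_zero p)
    · exact mul_dvd_mul_right ((pow_dvd_pow _ (by omega)).trans (he1 n)) _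

/-- The defining properties of the `p`-part `y` of `x`. -/
lemma exists_isProPElement_pPart {p : ℕ} (hp : p.Prime) (x : G) :
    ∃ y ∈ (zpowers x).topologicalClosure, IsProPElement p y ∧
      ∀ U : OpenNormalSubgroup G, ∃ m : ℕ, ¬ p ∣ m ∧ (x * y⁻¹) ^ m ∈ U ∧ (y ^ m)⁻¹ * x ^ m ∈ U := by
  obtain ⟨y, hy, h⟩ := exists_pPart hp x
  have hmk : ∀ (U : OpenNormalSubgroup G) (g : G), g ∈ U ↔ (g : G ⧸ (U : Subgroup G)) = 1 :=
    fun U g => (QuotientGroup.eq_one_iff _).symm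
  refine ⟨y, hy, fun U => ?_, fun U => ?_⟩ <;> obtain ⟨e, k, m, hm, h1, h2, h3⟩ := h U <;>
    simp only [hmk, QuotientGroup.mk_mul, QuotientGroup.mk_inv, QuotientGroup.mk_pow,
      QuotientGroup.mk_zpow] at h1 h2 h3 ⊢ <;> rw [inv_mul_eq_one] at h1
  · refine ⟨k, ?_⟩
    rw [h1, ← zpow_natCast, ← zpow_mul]
    exact_mod_cast h2
  · refine ⟨m, hm, ?_, ?_⟩
    · rw [h1, ← zpow_neg, mul_self_zpow, neg_add_eq_sub, ← zpow_natCast, ← zpow_mul, h3]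
    · rw [h1, ← zpow_natCast, ← zpow_natCast, ← zpow_mul, ← zpow_neg, ← zpow_add]
      rw [← h3]; congr 1; ring

variable [TotallyDisconnectedSpace G]

lemma isProP_of_forall_isProPElement {p : ℕ} {H : Subgroup G}
    (hH : ∀ h ∈ H, IsProPElement p h) : IsProP H p := by
  intro V q
  obtain ⟨h, rfl⟩ := QuotientGroup.mk_surjective q
  obtain ⟨O, hO, hOV⟩ := isOpen_induced_iff.1 V.isOpen'
  have h1 : (1 : G) ∈ O := by
    have : (1 : H) ∈ Subtype.val ⁻¹' O := by rw [hOV]; exact V.one_mem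
    exact this
  obtain ⟨U, hU⟩ := ProfiniteGrp.exist_openNormalSubgroup_sub_open_nhds_of_one hO h1
  obtain ⟨k, hk⟩ := hH h h.2 U
  refine ⟨k, ?_⟩
  rw [← QuotientGroup.mk_pow]
  refine (QuotientGroup.eq_one_iff _).2 ?_
  have : h ^ p ^ k ∈ Subtype.val ⁻¹' O := hU hk
  rw [hOV] at this
  exact this

/-- In a profinite group, a closed subgroup is the intersection of its products with open normal
subgroups. -/
lemma mem_of_forall_mem_sup {K : Subgroup G} (hK : IsClosed (K : Set G)) {x : G}
    (h : ∀ U : OpenNormalSubgroup G, x ∈ K ⊔ (U : Subgroup G)) : x ∈ K := by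
  by_contra hx
  obtain ⟨U, hU⟩ := ProfiniteGrp.exist_openNormalSubgroup_sub_open_nhds_of_one
    (U := (fun u => x * u⁻¹) ⁻¹' (K : Set G)ᶜ) (hK.isOpen_compl.preimage (by fun_prop))
    (by simpa using hx)
  obtain ⟨k, hk, u, hu, rfl⟩ := mem_sup_of_normal_right.1 (h U)
  exact hU hu (by simpa using hk)

end PElements

/-! ### Quasisimple subgroups: interaction with normal subgroups, and lifting through central
kernels. -/

section Quasisimple

variable {G : Type*} [Group G]

lemma commutatorElement_mul_mul_of_central {m n z w : G} (hz : n * w * z = z * (n * w))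
    (hw : m * w = w * m) : ⁅m * z, n * w⁆ = ⁅m, n⁆ := by
  have e1 : (m * z) * (n * w) = m * n * w * z := by
    rw [mul_assoc m z, ← hz]; simp only [mul_assoc]
  have e2 : (n * w) * (m * z) = n * m * w * z := by
    rw [mul_assoc n w, ← mul_assoc w m, ← hw]; simp only [mul_assoc]
  rw [commutatorElement_def, commutatorElement_def, mul_assoc (m * z * (n * w)), ← mul_inv_rev,
    e1, e2]
  group

lemma subgroupOf_normal_of_commutator_le {M Q : Subgroup G} (h : ⁅M, Q⁆ ≤ M) :
    (M.subgroupOf Q).Normal := ⟨fun m hm q => by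
  have := h (commutator_mem_commutator hm q.2)
  rw [mem_subgroupOf] at hm ⊢
  have h2 := mul_mem (inv_mem this) hm
  simpa [commutatorElement_def, mul_assoc] using h2⟩

variable [TopologicalSpace G]

lemma isClosed_map [CompactSpace G] {G' : Type*} [Group G'] [TopologicalSpace G'] [T2Space G']
    {φ : G →* G'} (hφ : Continuous φ) {H : Subgroup G} (hH : IsClosed (H : Set G)) :
    IsClosed (H.map φ : Set G') :=
  (hH.isCompact.image hφ).isClosed

variable [IsTopologicalGroup G]

/-- Quasisimplicity of a closed subgroup, expressed inside the ambient group. -/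
structure IsQuasisimpleSubgroup (Q : Subgroup G) : Prop where
  isClosed : IsClosed (Q : Set G)
  perfect : Q ≤ ⁅Q, Q⁆.topologicalClosure
  ne_bot : Q ≠ ⊥
  central_or_eq : ∀ M ≤ Q, IsClosed (M : Set G) → ⁅M, Q⁆ ≤ M → ⁅M, Q⁆ = ⊥ ∨ M = Q

lemma isClosed_centralizer [T2Space G] (s : Set G) : IsClosed (centralizer s : Set G) :=
  Set.isClosed_centralizer s

lemma topologicalClosure_bot [T2Space G] : (⊥ : Subgroup G).topologicalClosure = ⊥ :=
  le_bot_iff.1 (topologicalClosure_minimal _ le_rfl (by simp))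

/-- A perfect subgroup acting nilpotently with class two acts trivially. -/
lemma commutator_eq_bot_of_perfect [T2Space G] {M Q : Subgroup G}
    (hQ : Q ≤ ⁅Q, Q⁆.topologicalClosure) (h : ⁅⁅M, Q⁆, Q⁆ = ⊥) : ⁅M, Q⁆ = ⊥ := by
  -- Three subgroups lemma.
  have h1 : ⁅⁅Q, Q⁆, M⁆ = ⊥ :=
    commutator_commutator_eq_bot_of_rotate (by rwa [commutator_comm Q M]) h
  rw [commutator_comm, commutator_eq_bot_iff_le_centralizer]
  rw [commutator_eq_bot_iff_le_centralizer] at h1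
  exact hQ.trans (topologicalClosure_minimal _ h1 (isClosed_centralizer _))

lemma IsQuasisimpleSubgroup.not_commutative [T2Space G] {Q : Subgroup G}
    (hQ : IsQuasisimpleSubgroup Q) : ⁅Q, Q⁆ ≠ ⊥ := fun h => by
  have := hQ.perfect
  rw [h, topologicalClosure_bot] at this
  exact hQ.ne_bot (le_bot_iff.1 this)

/-- A normal subgroup centralises a perfect subnormal subgroup as soon as their intersection
does. -/
lemma commutator_eq_bot_of_isSubnormal [T2Space G] {M Q : Subgroup G} [M.Normal]
    (hQ : Q ≤ ⁅Q, Q⁆.topologicalClosure) (hsn : Q.IsSubnormal) (h : ⁅M ⊓ Q, Q⁆ = ⊥) :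
    ⁅M, Q⁆ = ⊥ := by
  -- Climb the chain from `Q` to `G`. When `H` is normal in `K`, `[M ∩ K, Q] ≤ M ∩ H`, so `[[M ∩ K,
  -- Q], Q] = 1` and perfectness removes one commutator.
  suffices ∀ H : Subgroup G, H.IsSubnormal → Q ≤ H → ⁅M ⊓ H, Q⁆ = ⊥ → ⁅M, Q⁆ = ⊥ from
    this Q hsn le_rfl h
  intro H hH
  induction hH with
  | top => intro _ h; simpa using h
  | step H K hHK _ hN ih =>
    intro hQH h
    rw [normal_subgroupOf_iff hHK] at hN
    refine ih (hQH.trans hHK) (commutator_eq_bot_of_perfect hQ (le_bot_iff.1 ?_))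
    refine le_trans (commutator_mono ?_ le_rfl) h.le
    refine commutator_le.2 fun m hm q hq => ⟨?_, ?_⟩
    · exact commutator_le_left M ⊤ (commutator_mem_commutator hm.1 trivial)
    · exact H.mul_mem (hN q m (hQH hq) hm.2) (H.inv_mem (hQH hq))

/-- A closed normal subgroup contains or centralises each subnormal quasisimple subgroup. -/
lemma IsQuasisimpleSubgroup.le_or_commutator_eq_bot [T2Space G] {M Q : Subgroup G} [M.Normal]
    (hQ : IsQuasisimpleSubgroup Q) (hsn : Q.IsSubnormal) (hM : IsClosed (M : Set G)) :
    Q ≤ M ∨ ⁅M, Q⁆ = ⊥ := by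
  have hle : ⁅M ⊓ Q, Q⁆ ≤ M ⊓ Q := le_inf
    ((commutator_mono inf_le_left le_rfl).trans (commutator_le_left M Q))
    ((commutator_mono inf_le_right le_rfl).trans (commutator_le_self Q))
  obtain h | h := hQ.central_or_eq (M ⊓ Q) inf_le_right (hM.inter hQ.isClosed) hle
  · exact Or.inr (commutator_eq_bot_of_isSubnormal hQ.perfect hsn h)
  · exact Or.inl (inf_eq_right.1 h)

lemma map_topologicalClosure_le {G' : Type*} [Group G'] [TopologicalSpace G']
    [IsTopologicalGroup G'] {φ : G →* G'} (hφ : Continuous φ) (H : Subgroup G) :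
    H.topologicalClosure.map φ ≤ (H.map φ).topologicalClosure := by
  rintro _ ⟨x, hx, rfl⟩
  exact image_closure_subset_closure_image hφ ⟨x, hx, rfl⟩

/-- The image of `M` in the simple group `Q/Z(Q)` is trivial, making `M` central, or everything. In
the second case `Q = M Z(Q)`, so `[Q, Q] ≤ M` and perfectness gives `M = Q`. -/
lemma isQuasisimpleSubgroup_of_isQuasisimple [T2Space G] [CompactSpace G] {Q : Subgroup G}
    (hcl : IsClosed (Q : Set G)) (hQ : IsQuasisimple Q) : IsQuasisimpleSubgroup Q := by
  obtain ⟨hperf, hnt, hsimple⟩ := hQ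
  have hmap : (commutator Q).map Q.subtype = ⁅Q, Q⁆ := by
    rw [commutator_def, map_commutator, ← MonoidHom.range_eq_map, range_subtype]
  have hpf : Q ≤ ⁅Q, Q⁆.topologicalClosure := by
    intro q hq
    have h1 : (⟨q, hq⟩ : Q) ∈ (commutator Q).topologicalClosure := by
      rw [show _ = _ from hperf]; trivial
    have h2 := map_topologicalClosure_le continuous_subtype_val _ (mem_map_of_mem Q.subtype h1)
    rwa [hmap] at h2
  refine ⟨hcl, hpf, ?_, fun M hMQ hM hMn => ?_⟩
  · rintro rfl
    obtain ⟨a, b, hab⟩ := hnt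
    obtain ⟨a, rfl⟩ := QuotientGroup.mk_surjective a
    obtain ⟨b, rfl⟩ := QuotientGroup.mk_surjective b
    exact hab (congrArg _ (Subsingleton.elim a b))
  · have : CompactSpace Q := isCompact_iff_compactSpace.1 hcl.isCompact
    have := subgroupOf_normal_of_commutator_le hMn
    have hcen : IsClosed (center Q : Set Q) := by
      rw [← centralizer_univ]; exact isClosed_centralizer _
    have hM' : IsClosed (M.subgroupOf Q : Set Q) := hM.preimage continuous_subtype_val
    obtain h | h := hsimple ((M.subgroupOf Q).map (QuotientGroup.mk' (center Q)))
      (Normal.map inferInstance _ (QuotientGroup.mk'_surjective _))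
      (isClosed_map (φ := QuotientGroup.mk' (center Q)) QuotientGroup.continuous_mk hM')
    · left
      rw [commutator_eq_bot_iff_le_centralizer]
      intro m hm q hq
      have h1 : (⟨m, hMQ hm⟩ : Q) ∈ center Q := by
        rw [Subgroup.map_eq_bot_iff, QuotientGroup.ker_mk'] at h
        exact h hm
      exact congrArg Subtype.val (mem_center_iff.1 h1 ⟨q, hq⟩)
    · right
      refine le_antisymm hMQ (hpf.trans (topologicalClosure_minimal _ ?_ hM))
      have hdec : ∀ q ∈ Q, ∃ m ∈ M, ∃ z ∈ Q, (∀ x ∈ Q, x * z = z * x) ∧ q = m * z := by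
        intro q hq
        have h1 : QuotientGroup.mk' (center Q) ⟨q, hq⟩ ∈
          (M.subgroupOf Q).map (QuotientGroup.mk' (center Q)) := by rw [h]; trivial
        obtain ⟨m, hm, hmq⟩ := h1
        have h2 : m⁻¹ * ⟨q, hq⟩ ∈ center Q := QuotientGroup.eq.1 hmq
        refine ⟨m, hm, (m⁻¹ * ⟨q, hq⟩ : Q), (m⁻¹ * ⟨q, hq⟩ : Q).2, fun x hx => ?_, by simp⟩
        exact congrArg Subtype.val (mem_center_iff.1 h2 ⟨x, hx⟩)
      refine commutator_le.2 fun a ha b hb => ?_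
      obtain ⟨m, hm, z, hz, hzc, rfl⟩ := hdec a ha
      obtain ⟨n, hn, w, hw, hwc, rfl⟩ := hdec b hb
      rw [commutatorElement_mul_mul_of_central (hzc _ hb) (hwc _ (hMQ hm))]
      exact mul_mem (mul_mem (mul_mem hm hn) (inv_mem hm)) (inv_mem hn)

lemma IsQuasisimpleSubgroup.isQuasisimple [T2Space G] [CompactSpace G] {Q : Subgroup G}
    (hQ : IsQuasisimpleSubgroup Q) : IsQuasisimple Q := by
  have : CompactSpace Q := isCompact_iff_compactSpace.1 hQ.isClosed.isCompact
  have hmap : (commutator Q).map Q.subtype = ⁅Q, Q⁆ := by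
    rw [commutator_def, map_commutator, ← MonoidHom.range_eq_map, range_subtype]
  refine ⟨?_, ?_, fun N hN hNcl => ?_⟩
  · refine eq_top_iff.2 fun q _ => ?_
    have h1 : ((commutator Q).topologicalClosure).map Q.subtype = Q := by
      refine le_antisymm (map_subtype_le _) (hQ.perfect.trans (topologicalClosure_minimal _ ?_ ?_))
      · rw [← hmap]
        exact map_mono (le_topologicalClosure _)
      · exact isClosed_map continuous_subtype_val (isClosed_topologicalClosure _)
    obtain ⟨x, hx, hxq⟩ : (q : G) ∈ ((commutator Q).topologicalClosure).map Q.subtype := by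
      rw [h1]; exact q.2
    rwa [← Subtype.ext hxq]
  · rw [QuotientGroup.nontrivial_iff]
    intro h
    refine hQ.not_commutative ?_
    rw [commutator_eq_bot_iff_le_centralizer]
    intro m hm q hq
    have h1 : (⟨m, hm⟩ : Q) ∈ center Q := by rw [h]; trivial
    exact congrArg Subtype.val (mem_center_iff.1 h1 ⟨q, hq⟩)
  · set M : Subgroup Q := N.comap (QuotientGroup.mk' (center Q)) with hMdef
    have hMn : M.Normal := inferInstance
    have hMcl : IsClosed (M : Set Q) := hNcl.preimage QuotientGroup.continuous_mk
    have hN' : M.map (QuotientGroup.mk' (center Q)) = N :=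
      map_comap_eq_self_of_surjective (QuotientGroup.mk'_surjective _) N
    obtain h | h := hQ.central_or_eq (M.map Q.subtype) (map_subtype_le M)
      (isClosed_map continuous_subtype_val hMcl) (by
        refine commutator_le.2 ?_
        rintro _ ⟨m, hm, rfl⟩ q hq
        exact ⟨⁅m, ⟨q, hq⟩⁆, commutator_le_left M ⊤ (commutator_mem_commutator hm trivial), rfl⟩)
    · left
      rw [← hN', Subgroup.map_eq_bot_iff, QuotientGroup.ker_mk']
      intro m hm
      rw [commutator_eq_bot_iff_le_centralizer] at h
      exact mem_center_iff.2 fun q => Subtype.ext (h (mem_map_of_mem _ hm) q q.2)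
    · right
      have hM : M = ⊤ := by
        refine eq_top_iff.2 fun q _ => ?_
        obtain ⟨x, hx, hxq⟩ : (q : G) ∈ M.map Q.subtype := by rw [h]; exact q.2
        rwa [← Subtype.ext hxq]
      rw [← hN', hM, map_top_of_surjective _ (QuotientGroup.mk'_surjective _)]

/-- If `N` maps onto a quasisimple group with central kernel, then the closure of `[N, N]` is
quasisimple. -/
lemma isQuasisimpleSubgroup_commutator_of_map [T2Space G] [CompactSpace G] {G' : Type*} [Group G']
    [TopologicalSpace G'] [IsTopologicalGroup G'] [T2Space G'] {φ : G →* G'} (hφ : Continuous φ)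
    {N : Subgroup G} (hN : IsClosed (N : Set G)) (hQ : IsQuasisimpleSubgroup (N.map φ))
    (hker : ∀ z ∈ N, φ z = 1 → ∀ n ∈ N, n * z = z * n) :
    IsQuasisimpleSubgroup ⁅N, N⁆.topologicalClosure := by
  set T := ⁅N, N⁆.topologicalClosure with hT
  have hTcl : IsClosed (T : Set G) := isClosed_topologicalClosure _
  have hTN : T ≤ N := topologicalClosure_minimal _ (commutator_le_self N) hN
  -- If `M` covers the image, each element of `N` is one of `M` times one central in `N`, and
  -- central factors drop out of commutators.
  have hle : ∀ M ≤ N, M.map φ = N.map φ → ⁅N, N⁆ ≤ ⁅M, M⁆ := by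
    intro M hMN h
    have hdec : ∀ q ∈ N, ∃ m ∈ M, ∃ z : G, (∀ x ∈ N, x * z = z * x) ∧ q = m * z := by
      intro q hq
      obtain ⟨m, hm, hmq⟩ : φ q ∈ M.map φ := by rw [h]; exact mem_map_of_mem _ hq
      refine ⟨m, hm, m⁻¹ * q, hker _ (mul_mem (inv_mem (hMN hm)) hq) ?_, by simp⟩
      rw [map_mul, map_inv, hmq, inv_mul_cancel]
    refine commutator_le.2 fun a ha b hb => ?_
    obtain ⟨m, hm, z, hzc, rfl⟩ := hdec a ha
    obtain ⟨n, hn, w, hwc, rfl⟩ := hdec b hb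
    rw [commutatorElement_mul_mul_of_central (hzc _ hb) (hwc _ (hMN hm))]
    exact commutator_mem_commutator hm hn
  have hφT : T.map φ = N.map φ := by
    refine le_antisymm (map_mono hTN) (hQ.perfect.trans (topologicalClosure_minimal _ ?_
      (isClosed_map hφ hTcl)))
    rw [← map_commutator]
    exact map_mono (le_topologicalClosure _)
  have hperf : T ≤ ⁅T, T⁆.topologicalClosure := topologicalClosure_mono (hle T hTN hφT)
  refine ⟨hTcl, hperf, ?_, fun M hMT hM hMn => ?_⟩
  · intro h
    rw [h, Subgroup.map_bot] at hφT
    exact hQ.ne_bot hφT.symm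
  · have hMn' : ⁅M.map φ, N.map φ⁆ ≤ M.map φ := by
      rw [← hφT, ← map_commutator]
      exact map_mono hMn
    obtain h | h := hQ.central_or_eq (M.map φ) (map_mono (hMT.trans hTN)) (isClosed_map hφ hM) hMn'
    · left
      -- Here `[M, T]` lies in the kernel, hence is central in `N`.
      refine commutator_eq_bot_of_perfect hperf ?_
      rw [commutator_eq_bot_iff_le_centralizer]
      intro x hx n hn
      refine hker x (hTN (hMT (hMn hx))) ?_ n (hTN hn)
      have h1 := mem_map_of_mem φ hx
      rw [map_commutator, hφT, h] at h1
      exact h1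
    · right
      exact le_antisymm hMT (topologicalClosure_minimal _
        ((hle M (hMT.trans hTN) h).trans (commutator_le_self M)) hM)

lemma IsQuasisimpleSubgroup.conj [T2Space G] [CompactSpace G] {Q : Subgroup G}
    (hQ : IsQuasisimpleSubgroup Q) (g : G) :
    IsQuasisimpleSubgroup (Q.map (MulAut.conj g).toMonoidHom) := by
  have hc : ∀ g : G, Continuous (MulAut.conj g).toMonoidHom := fun g => by
    show Continuous fun x => g * x * g⁻¹
    fun_prop
  set N := Q.map (MulAut.conj g).toMonoidHom
  have hN : IsClosed (N : Set G) := isClosed_map (hc g) hQ.isClosed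
  have hback : N.map (MulAut.conj g⁻¹).toMonoidHom = Q := by
    rw [Subgroup.map_map]
    convert Subgroup.map_id Q
    ext x
    simp [mul_assoc]
  have hT : ⁅N, N⁆.topologicalClosure = N := by
    refine le_antisymm (topologicalClosure_minimal _ (commutator_le_self N) hN) ?_
    refine (map_mono hQ.perfect).trans ((map_topologicalClosure_le (hc g) _).trans ?_)
    rw [map_commutator]
  rw [← hT]
  -- Conjugation back by `g⁻¹` has trivial kernel, so the lifting lemma applies with image `Q`.
  refine isQuasisimpleSubgroup_commutator_of_map (hc g⁻¹) hN (hback ▸ hQ) fun z _ hz n _ => ?_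
  rw [(MulEquiv.map_eq_one_iff (MulAut.conj g⁻¹)).1 hz]
  simp

end Quasisimple

/-! ### The pro-Fitting subgroup, the layer and the centraliser of a normal section. -/

section Fitting

variable {G : Type*} [Group G]

lemma sSup_normal_of_conj {S : Set (Subgroup G)}
    (h : ∀ H ∈ S, ∀ g : G, H.map (MulAut.conj g).toMonoidHom ∈ S) : (sSup S).Normal :=
  ⟨fun x hx g => by
    have hle : sSup S ≤ (sSup S).comap (MulAut.conj g).toMonoidHom :=
      sSup_le fun H hH => map_le_iff_le_comap.1 (le_sSup (h H hH g))
    exact hle hx⟩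

lemma map_subtype_center (H : Subgroup G) :
    (center H).map H.subtype = H ⊓ centralizer (H : Set G) := by
  ext x
  constructor
  · rintro ⟨z, hz, rfl⟩
    exact ⟨z.2, fun h hh => congrArg Subtype.val (mem_center_iff.1 hz ⟨h, hh⟩)⟩
  · rintro ⟨hx, hxc⟩
    exact ⟨⟨x, hx⟩, mem_center_iff.2 fun h => Subtype.ext (hxc h h.2), rfl⟩

lemma mem_of_pow_mem_of_coprime {H : Subgroup G} {z : G} {a b : ℕ} (hab : a.Coprime b)
    (ha : z ^ a ∈ H) (hb : z ^ b ∈ H) : z ∈ H := by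
  have h : (a : ℤ) * a.gcdA b + b * a.gcdB b = 1 := by
    rw [← Nat.gcd_eq_gcd_ab, hab.gcd_eq_one, Nat.cast_one]
  rw [← zpow_one z, ← h, zpow_add, zpow_mul, zpow_mul, zpow_natCast, zpow_natCast]
  exact mul_mem (zpow_mem ha _) (zpow_mem hb _)

/-- The elements that act trivially by conjugation on `C / Z`. -/
def quotientCentralizer (C Z : Subgroup G) [Z.Normal] : Subgroup G :=
  (centralizer (C.map (QuotientGroup.mk' Z) : Set (G ⧸ Z))).comap (QuotientGroup.mk' Z)

lemma mem_quotientCentralizer {C Z : Subgroup G} [Z.Normal] {g : G} :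
    g ∈ quotientCentralizer C Z ↔ ∀ c ∈ C, ⁅g, c⁆ ∈ Z := by
  rw [quotientCentralizer, mem_comap, mem_centralizer_iff_commutator_eq_one]
  constructor
  · intro h c hc
    have := h _ (mem_map_of_mem (QuotientGroup.mk' Z) hc)
    rw [← map_commutatorElement] at this
    rw [← inv_mem_iff, commutatorElement_inv]
    exact (QuotientGroup.eq_one_iff _).1 this
  · rintro h _ ⟨c, hc, rfl⟩
    rw [← map_commutatorElement]
    refine (QuotientGroup.eq_one_iff _).2 ?_
    rw [← inv_mem_iff, commutatorElement_inv]
    exact h c hc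

instance quotientCentralizer_normal (C Z : Subgroup G) [C.Normal] [Z.Normal] :
    (quotientCentralizer C Z).Normal := by
  have : (C.map (QuotientGroup.mk' Z)).Normal :=
    Normal.map inferInstance _ (QuotientGroup.mk'_surjective Z)
  exact Normal.comap inferInstance _

variable [TopologicalSpace G] [IsTopologicalGroup G]

lemma layer_le_genProFitting : layer G ≤ genProFitting G :=
  le_sup_left.trans (le_topologicalClosure _)

lemma proFitting_le_genProFitting : proFitting G ≤ genProFitting G :=
  le_sup_right.trans (le_topologicalClosure _)

lemma IsComponent.le_genProFitting {Q : Subgroup G} (hQ : IsComponent Q) :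
    Q ≤ genProFitting G :=
  (le_sSup (show Q ∈ {Q : Subgroup G | IsComponent Q} from hQ)).trans
    ((le_topologicalClosure _).trans layer_le_genProFitting)

lemma isClosed_quotientCentralizer (C : Subgroup G) {Z : Subgroup G} [Z.Normal]
    (hZ : IsClosed (Z : Set G)) : IsClosed (quotientCentralizer C Z : Set G) := by
  have : (quotientCentralizer C Z : Set G) = ⋂ c ∈ C, (fun g : G => ⁅g, c⁆) ⁻¹' (Z : Set G) := by
    ext g
    simp [mem_quotientCentralizer]
  rw [this]
  refine isClosed_biInter fun c _ => hZ.preimage ?_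
  simp only [commutatorElement_def]
  fun_prop

lemma isClosed_map_conj [CompactSpace G] [T2Space G] {H : Subgroup G}
    (hH : IsClosed (H : Set G)) (g : G) :
    IsClosed (H.map (MulAut.conj g).toMonoidHom : Set G) := by
  refine isClosed_map ?_ hH
  show Continuous fun x => g * x * g⁻¹
  fun_prop

lemma IsClosedSubnormal.conj [CompactSpace G] [T2Space G] {H : Subgroup G}
    (hH : IsClosedSubnormal H) (g : G) :
    IsClosedSubnormal (H.map (MulAut.conj g).toMonoidHom) :=
  ⟨hH.1.map (MulAut.conj g).surjective, isClosed_map_conj hH.2 g⟩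

instance layer_normal [CompactSpace G] [T2Space G] : (layer G).Normal := by
  have : (sSup {Q : Subgroup G | IsComponent Q}).Normal := sSup_normal_of_conj fun Q hQ g =>
    ⟨hQ.1.conj g, ((isQuasisimpleSubgroup_of_isQuasisimple hQ.1.2 hQ.2).conj g).isQuasisimple⟩
  exact is_normal_topologicalClosure _

variable [CompactSpace G] [TotallyDisconnectedSpace G]

instance proFitting_normal : (proFitting G).Normal := by
  have : (sSup {H : Subgroup G | IsClosedSubnormal H ∧
      ∃ p : ℕ, p.Prime ∧ IsProP H p}).Normal := sSup_normal_of_conj <| by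
    rintro H ⟨hH, p, hp, hHp⟩ g
    refine ⟨hH.conj g, p, hp, isProP_of_forall_isProPElement ?_⟩
    rintro _ ⟨h, hh, rfl⟩
    exact (hHp.isProPElement hh).conj g
  exact is_normal_topologicalClosure _

instance genProFitting_normal : (genProFitting G).Normal :=
  is_normal_topologicalClosure _

lemma le_proFitting {p : ℕ} (hp : p.Prime) {P : Subgroup G} [hn : P.Normal]
    (hcl : IsClosed (P : Set G)) (hP : ∀ x ∈ P, IsProPElement p x) : P ≤ proFitting G :=
  le_trans (le_sSup (show P ∈ {H : Subgroup G | IsClosedSubnormal H ∧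
    ∃ p : ℕ, p.Prime ∧ IsProP H p} from
      ⟨⟨hn.isSubnormal, hcl⟩, p, hp, isProP_of_forall_isProPElement hP⟩))
    (le_topologicalClosure _)

/-- A closed normal subgroup with nilpotent finite images lies in the pro-Fitting subgroup. -/
lemma le_proFitting_of_isNilpotent {D : Subgroup G} [hn : D.Normal] (hcl : IsClosed (D : Set G))
    (hD : ∀ U : OpenNormalSubgroup G,
      Group.IsNilpotent (D.map (QuotientGroup.mk' (U : Subgroup G)))) :
    D ≤ proFitting G := by
  -- The pro-`p` elements of `D` form a closed normal subgroup, closed under products because the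
  -- finite images of `D` are nilpotent.
  have hPF : ∀ p : ℕ, p.Prime → ∀ x ∈ D, IsProPElement p x → x ∈ proFitting G := by
    intro p hp x hx hxp
    let P : Subgroup G :=
      { carrier := {x | x ∈ D ∧ IsProPElement p x}
        one_mem' := ⟨D.one_mem, fun U => ⟨0, by rw [one_pow]; exact U.one_mem⟩⟩
        inv_mem' := fun {x} hx => ⟨D.inv_mem hx.1, fun U => by
          obtain ⟨k, hk⟩ := hx.2 U
          exact ⟨k, by rw [inv_pow]; exact inv_mem hk⟩⟩
        mul_mem' := fun {x y} hx hy => ⟨D.mul_mem hx.1 hy.1, fun U => by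
          have : Finite (G ⧸ (U : Subgroup G)) := Subgroup.quotient_finite_of_isOpen _ U.isOpen'
          have := hD U
          have hmk : ∀ z (hz : z ∈ D) (k : ℕ), z ^ k ∈ U ↔
              (⟨_, mem_map_of_mem (QuotientGroup.mk' (U : Subgroup G)) hz⟩ :
                D.map (QuotientGroup.mk' (U : Subgroup G))) ^ k = 1 := by
            intro z hz k
            rw [Subtype.ext_iff]
            exact (QuotientGroup.eq_one_iff (N := (U : Subgroup G)) (z ^ k)).symm
          obtain ⟨k, hk⟩ := exists_mul_pow_eq_one_of_isNilpotent hp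
            ((hx.2 U).imp fun k => (hmk x hx.1 _).1) ((hy.2 U).imp fun k => (hmk y hy.1 _).1)
          exact ⟨k, (hmk _ (D.mul_mem hx.1 hy.1) _).2 hk⟩⟩ }
    have : P.Normal := ⟨fun x hx g => ⟨hn.conj_mem x hx.1 g, hx.2.conj g⟩⟩
    exact le_proFitting hp (P := P) (hcl.inter (isClosed_setOf_isProPElement p))
      (fun x hx => hx.2) ⟨hx, hxp⟩
  intro x hx
  refine mem_of_forall_mem_sup (isClosed_topologicalClosure _) fun U => ?_
  change x ∈ proFitting G ⊔ (U : Subgroup G)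
  by_contra hxS
  set S : Subgroup G := proFitting G ⊔ (U : Subgroup G)
  have hne : orderOf (x : G ⧸ S) ≠ 1 := fun h =>
    hxS ((QuotientGroup.eq_one_iff x).1 (orderOf_eq_one_iff.1 h))
  -- For a prime `p` dividing the order of `x` modulo `S`, the `p`-part `y` lies in `F(G)`. Since `x
  -- ^ m` and `y ^ m` agree modulo `U`, the order divides some `m` prime to `p`, a contradiction.
  obtain ⟨p, hp, hpd⟩ := Nat.exists_prime_and_dvd hne
  obtain ⟨y, hy, hyp, h⟩ := exists_isProPElement_pPart hp x
  have hyD : y ∈ D := topologicalClosure_minimal _ (by simpa using hx) hcl hy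
  obtain ⟨m, hm, -, hmU⟩ := h U
  refine hm (hpd.trans (orderOf_dvd_of_pow_eq_one ?_))
  rw [← QuotientGroup.mk_pow]
  refine (QuotientGroup.eq_one_iff _).2 ?_
  have := mul_mem (mem_sup_left (T := (U : Subgroup G)) (pow_mem (hPF p hp y hyD hyp) m))
    (mem_sup_right (S := proFitting G) hmU)
  simpa using this

/-- The centre of the pro-Fitting subgroup centralises every component. -/
lemma inf_centralizer_le_centralizer_genProFitting :
    proFitting G ⊓ centralizer (proFitting G : Set G) ≤
      centralizer (genProFitting G : Set G) := by
  set A := proFitting G ⊓ centralizer (proFitting G : Set G) with hA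
  have hAcl : IsClosed (A : Set G) :=
    (isClosed_topologicalClosure _).inter (isClosed_centralizer _)
  have hAA : ⁅A, A⁆ = ⊥ := commutator_eq_bot_iff_le_centralizer.2 fun x hx y hy => hx.2 y hy.1
  rw [le_centralizer_iff]
  refine topologicalClosure_minimal _ (sup_le ?_ ?_) (isClosed_centralizer _)
  · refine topologicalClosure_minimal _ (sSup_le fun Q hQ => ?_) (isClosed_centralizer _)
    have hQ' := isQuasisimpleSubgroup_of_isQuasisimple hQ.1.2 hQ.2
    obtain h | h := hQ'.le_or_commutator_eq_bot hQ.1.1 hAcl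
    · exact absurd (le_bot_iff.1 ((commutator_mono h h).trans hAA.le)) hQ'.not_commutative
    · exact le_centralizer_iff.1 (commutator_eq_bot_iff_le_centralizer.1 h)
  · exact le_centralizer_iff.1 inf_le_right

/-! ### The quotient of `G` by the centraliser of `C / Z`. -/

section Centralizer

variable {C Z : Subgroup G} [C.Normal] [Z.Normal]

/-- If `Z = C ∩ F(G)` is central in `C`, then `C / Z` has trivial centre. -/
lemma inf_quotientCentralizer_le (hC : IsClosed (C : Set G)) (hZ : IsClosed (Z : Set G))
    (hZC : ∀ x ∈ C, x ∈ proFitting G → x ∈ Z) (hcomm : ∀ z ∈ Z, ∀ c ∈ C, c * z = z * c) :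
    C ⊓ quotientCentralizer C Z ≤ Z := by
  have hD : C ⊓ quotientCentralizer C Z ≤ proFitting G := by
    refine le_proFitting_of_isNilpotent (hC.inter (isClosed_quotientCentralizer C hZ)) fun U => ?_
    refine isNilpotent_of_forall_commutator_mem_center ?_
    rintro ⟨_, a, ha, rfl⟩ ⟨_, b, hb, rfl⟩
    refine mem_center_iff.2 ?_
    rintro ⟨_, c, hc, rfl⟩
    have h := hcomm _ (mem_quotientCentralizer.1 ha.2 b hb.1) c hc.1
    refine Subtype.ext ?_
    simpa [commutatorElement_def] using congrArg (QuotientGroup.mk' (U : Subgroup G)) h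
  exact fun x hx => hZC x hx.1 (hD hx)

/-- In the setting of `inf_quotientCentralizer_le`, every subnormal pro-`p` subgroup of the
quotient by the centraliser of `C / Z` is trivial. -/
lemma eq_bot_of_isProP_quotient (hC : IsClosed (C : Set G)) (hZ : IsClosed (Z : Set G))
    (hZC : ∀ x ∈ C, x ∈ proFitting G → x ∈ Z) (hcomm : ∀ z ∈ Z, ∀ c ∈ C, c * z = z * c)
    {H : Subgroup (G ⧸ quotientCentralizer C Z)} (hH : H.IsSubnormal) {p : ℕ} (hp : p.Prime)
    (hHp : IsProP H p) : H = ⊥ := by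
  have hCK := inf_quotientCentralizer_le hC hZ hZC hcomm
  have hK := isClosed_quotientCentralizer C hZ
  set K := quotientCentralizer C Z
  obtain ⟨P₀, hP₀n, hHP₀, hP₀⟩ := exists_normal_of_isSubnormal hH fun h => hHp.isProPElement
  set P := P₀.topologicalClosure
  have hPn : P.Normal := is_normal_topologicalClosure P₀
  have hPp : ∀ h ∈ P, IsProPElement p h := fun h hh =>
    closure_minimal (fun x hx => hP₀ x hx) (isClosed_setOf_isProPElement p) hh
  set X := P.comap (QuotientGroup.mk' K)
  have hXcl : IsClosed (X : Set G) :=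
    (isClosed_topologicalClosure P₀).preimage QuotientGroup.continuous_mk
  have hXn : X.Normal := hPn.comap _
  have hDcl : IsClosed ((X ⊓ C : Subgroup G) : Set G) := hXcl.inter hC
  -- The `p'`-part `x * y⁻¹` is a pro-`p` element modulo `K` but has order prime to `p` modulo each
  -- `U`. It therefore lies in every `K U`, hence in `K ∩ C ≤ Z`.
  have hpart : ∀ x ∈ X ⊓ C, ∃ y ∈ C, IsProPElement p y ∧ x * y⁻¹ ∈ Z := by
    intro x hx
    obtain ⟨y, hy, hyp, h⟩ := exists_isProPElement_pPart hp x
    have hyD : y ∈ X ⊓ C := topologicalClosure_minimal _ (by simpa using hx) hDcl hy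
    have hz := mul_mem hx (inv_mem hyD)
    refine ⟨y, hyD.2, hyp, hCK ⟨hz.2, mem_of_forall_mem_sup hK fun U => ?_⟩⟩
    let V : OpenNormalSubgroup (G ⧸ K) :=
      { toSubgroup := (U : Subgroup G).map (QuotientGroup.mk' K)
        isOpen' := QuotientGroup.isOpenMap_coe _ U.isOpen'
        isNormal' := Normal.map inferInstance _ (QuotientGroup.mk'_surjective K) }
    obtain ⟨k, u, hu, huk⟩ := hPp _ hz.1 V
    obtain ⟨m, hm, hmU, -⟩ := h U
    refine mem_of_pow_mem_of_coprime (((hp.coprime_iff_not_dvd.2 hm).pow_left k)) ?_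
      (mem_sup_right hmU)
    rw [← map_pow] at huk
    have := mul_mem (mem_sup_right (S := K) hu)
      (mem_sup_left (T := (U : Subgroup G)) (QuotientGroup.eq.1 huk))
    simpa using this
  have hDF : X ⊓ C ≤ proFitting G := by
    refine le_proFitting_of_isNilpotent hDcl fun U => ?_
    have : Finite (G ⧸ (U : Subgroup G)) := Subgroup.quotient_finite_of_isOpen _ U.isOpen'
    -- Modulo `U`, a suitable `p`-power kills `y`, and so sends `x` to a power of the central factor
    -- `x * y⁻¹`.
    refine isNilpotent_of_forall_exists_pow_mem_center hp ?_
    rintro ⟨_, x, hx, rfl⟩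
    obtain ⟨y, hy, hyp, hz⟩ := hpart x hx
    obtain ⟨k, hk⟩ := hyp U
    refine ⟨k, mem_center_iff.2 ?_⟩
    rintro ⟨_, c, hc, rfl⟩
    have hxk : QuotientGroup.mk' (U : Subgroup G) x ^ p ^ k =
        QuotientGroup.mk' (U : Subgroup G) ((x * y⁻¹) ^ p ^ k) := by
      have hxy : x ^ p ^ k = (x * y⁻¹) ^ p ^ k * y ^ p ^ k := by
        rw [← (show Commute (x * y⁻¹) y from (hcomm _ hz y hy).symm).mul_pow]
        simp
      rw [← map_pow, hxy, map_mul, show QuotientGroup.mk' (U : Subgroup G) (y ^ p ^ k) = 1 from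
        (QuotientGroup.eq_one_iff _).2 hk, mul_one]
    have h := congrArg (QuotientGroup.mk' (U : Subgroup G)) (hcomm _ (pow_mem hz (p ^ k)) c hc.2)
    rw [map_mul, map_mul, ← hxk] at h
    exact Subtype.ext h
  refine le_bot_iff.1 fun h hh => ?_
  obtain ⟨x, rfl⟩ := QuotientGroup.mk_surjective h
  have hx : x ∈ X := le_topologicalClosure _ (hHP₀ hh)
  refine (QuotientGroup.eq_one_iff x).2 (mem_quotientCentralizer.2 fun c hc => ?_)
  have hD : ⁅x, c⁆ ∈ X ⊓ C := ⟨commutator_le_left X ⊤ (commutator_mem_commutator hx trivial),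
    commutator_le_right ⊤ C (commutator_mem_commutator trivial hc)⟩
  exact hZC _ hD.2 (hDF hD)

/-- In the setting of `inf_quotientCentralizer_le`, a component of the quotient by the centraliser
of `C / Z` yields a component of `G` inside `C`. -/
lemma exists_isComponent_le_of_quotient (hC : IsClosed (C : Set G)) (hZ : IsClosed (Z : Set G))
    (hZC : ∀ x ∈ C, x ∈ proFitting G → x ∈ Z) (hcomm : ∀ z ∈ Z, ∀ c ∈ C, c * z = z * c)
    {Q : Subgroup (G ⧸ quotientCentralizer C Z)} (hQ : IsComponent Q) :
    ∃ T ≤ C, IsComponent T := by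
  have hCK := inf_quotientCentralizer_le hC hZ hZC hcomm
  have hK := isClosed_quotientCentralizer C hZ
  set K := quotientCentralizer C Z
  have hcont : Continuous (QuotientGroup.mk' K) := QuotientGroup.continuous_mk
  have hQ' := isQuasisimpleSubgroup_of_isQuasisimple hQ.1.2 hQ.2
  have : (C.map (QuotientGroup.mk' K)).Normal :=
    Normal.map inferInstance _ (QuotientGroup.mk'_surjective K)
  obtain h | h := hQ'.le_or_commutator_eq_bot hQ.1.1 (isClosed_map hcont hC)
  -- `N` maps onto `Q` with kernel `N ∩ K ≤ Z`, central in `C`; the closure of `[N, N]` is the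
  -- required component.
  · set N := Q.comap (QuotientGroup.mk' K) ⊓ C
    have hNcl : IsClosed (N : Set G) := (hQ.1.2.preimage hcont).inter hC
    have hNsn : N.IsSubnormal := (hQ.1.1.comap _).inf (Normal.isSubnormal inferInstance)
    have hNmap : N.map (QuotientGroup.mk' K) = Q := by
      refine le_antisymm (map_le_iff_le_comap.2 inf_le_left) fun q hq => ?_
      obtain ⟨c, hc, rfl⟩ := h hq
      exact ⟨c, ⟨hq, hc⟩, rfl⟩
    have hT := isQuasisimpleSubgroup_commutator_of_map hcont hNcl (hNmap.symm ▸ hQ')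
      fun z hz hz1 n hn => hcomm z (hCK ⟨hz.2, (QuotientGroup.eq_one_iff z).1 hz1⟩) n hn.2
    have hTN : ⁅N, N⁆.topologicalClosure ≤ N :=
      topologicalClosure_minimal _ (commutator_le_self N) hNcl
    refine ⟨_, hTN.trans inf_le_right, ⟨IsSubnormal.step _ N hTN hNsn ?_, hT.isClosed⟩,
      hT.isQuasisimple⟩
    exact subgroupOf_normal_of_commutator_le
      ((commutator_mono hTN le_rfl).trans (le_topologicalClosure _))
  -- If `Q` centralises the image of `C`, a lift `x` satisfies `[x, C] ≤ C ∩ K ≤ Z`, so `x ∈ K` and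
  -- `Q` is trivial.
  · refine absurd (le_bot_iff.1 fun q hq => ?_) hQ'.ne_bot
    obtain ⟨x, rfl⟩ := QuotientGroup.mk_surjective q
    refine (QuotientGroup.eq_one_iff x).2 (mem_quotientCentralizer.2 fun c hc => hCK ⟨?_, ?_⟩)
    · exact commutator_le_right ⊤ C (commutator_mem_commutator trivial hc)
    · show ⁅x, c⁆ ∈ K
      rw [← inv_mem_iff, commutatorElement_inv]
      refine (QuotientGroup.eq_one_iff _).1 ?_
      have h1 := commutator_mem_commutator (mem_map_of_mem (QuotientGroup.mk' K) hc) hq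
      rw [h] at h1
      exact h1

end Centralizer

/-- In a Fitting-regular profinite group, the generalised pro-Fitting subgroup has its centraliser
inside the pro-Fitting subgroup. -/
lemma centralizer_genProFitting_le_proFitting (hG : IsFittingRegular G) :
    centralizer (genProFitting G : Set G) ≤ proFitting G := by
  set C := centralizer (genProFitting G : Set G)
  have hC : IsClosed (C : Set G) := isClosed_centralizer _
  set Z := C ⊓ proFitting G
  have hZ : IsClosed (Z : Set G) := hC.inter (isClosed_topologicalClosure _)
  have hZC : ∀ x ∈ C, x ∈ proFitting G → x ∈ Z := fun x h1 h2 => ⟨h1, h2⟩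
  have hcomm : ∀ z ∈ Z, ∀ c ∈ C, c * z = z * c := fun z hz c hc =>
    (hc z (proFitting_le_genProFitting hz.2)).symm
  have hK := isClosed_quotientCentralizer C hZ
  have hnt : ¬ Nontrivial (G ⧸ quotientCentralizer C Z) := by
    intro hnt
    refine hG _ hK hnt ?_
    have hlayer : layer (G ⧸ quotientCentralizer C Z) = ⊥ := by
      refine (congrArg _ (le_bot_iff.1 (sSup_le fun Q hQ => ?_))).trans topologicalClosure_bot
      obtain ⟨T, hTC, hT⟩ := exists_isComponent_le_of_quotient hC hZ hZC hcomm hQ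
      refine absurd ?_ (isQuasisimpleSubgroup_of_isQuasisimple hT.1.2 hT.2).not_commutative
      rw [commutator_eq_bot_iff_le_centralizer]
      -- `T` lies in both `C` and `F*(G)`, so it commutes with itself.
      exact hTC.trans (centralizer_le hT.le_genProFitting)
    have hfit : proFitting (G ⧸ quotientCentralizer C Z) = ⊥ := by
      refine (congrArg _ (le_bot_iff.1 (sSup_le ?_))).trans topologicalClosure_bot
      rintro H ⟨hH, p, hp, hHp⟩
      exact (eq_bot_of_isProP_quotient hC hZ hZC hcomm hH.1 hp hHp).le
    show (layer _ ⊔ proFitting _).topologicalClosure = ⊥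
    rw [hlayer, hfit, bot_sup_eq, topologicalClosure_bot]
  rw [QuotientGroup.nontrivial_iff, not_not] at hnt
  have h := inf_quotientCentralizer_le hC hZ hZC hcomm
  rw [hnt, inf_top_eq] at h
  exact h.trans inf_le_right

end Fitting

end ProfiniteFitting

theorem theorem4p4p1 {G : Type*} [Group G] [TopologicalSpace G] [IsTopologicalGroup G]
    [CompactSpace G] [TotallyDisconnectedSpace G]
    (hG : ProfiniteFitting.IsFittingRegular G) :
    Subgroup.centralizer (ProfiniteFitting.genProFitting G : Set G) =
        (Subgroup.center (ProfiniteFitting.proFitting G)).map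
          (ProfiniteFitting.proFitting G).subtype ∧
      Subgroup.centralizer (ProfiniteFitting.genProFitting G : Set G) ≤
        ProfiniteFitting.genProFitting G := by
  have h := ProfiniteFitting.centralizer_genProFitting_le_proFitting hG
  refine ⟨?_, h.trans ProfiniteFitting.proFitting_le_genProFitting⟩
  rw [ProfiniteFitting.map_subtype_center]
  exact le_antisymm
    (le_inf h (Subgroup.centralizer_le ProfiniteFitting.proFitting_le_genProFitting))
    ProfiniteFitting.inf_centralizer_le_centralizer_genProFitting
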